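/- A JB$^*$-triple is a complex Banach space $E$ with a triple product $\{\cdot,\cdot,\cdot\}:E^3\to E$, linear and symmetric in the outer variables and conjugate linear in the middle one, such that $\{a,b,\{x,y,z\}\}=\{\{a,b,x\},y,z\}-\{x,\{b,a,y\},z\}+\{x,y,\{a,b,z\}\}$ for all $a,b,x,y,z\in E$, every operator $L(a,a):x\mapsto\{a,a,x\}$ is a bounded hermitian operator (that is, with real numerical range) with non-negative spectrum, and $\|\{x,x,x\}\|=\|x\|^3$ for all $x\in E$. Let $E$ be a JB$^*$-triple, let $a\in E$ with $\|a\|=1$, and let $\varphi\in E^*$ with $\|\varphi\|=1$ and $\varphi(a)=1$. Let $E_a$ be the JB$^*$-subtriple of $E$ generated by $a$, that is, the smallest norm-closed linear subspace that contains $a$ and is closed under the triple product. Then: 1. The restriction of $\varphi$ to $E_a$ is a triple homomorphism, that is, $\varphi(\{x,y,z\})=\varphi(x)\overline{\varphi(y)}\varphi(z)$ for all $x,y,z\in E_a$. 2. Call a pair $(S,\Psi)$ a Gelfand identification of $E_a$ if $S\subseteq(0,1]$, $S\cup\{0\}$ is compact, and $\Psi:E_a\to C_0(S)$ is a linear bijection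 with $\Psi(\{x,y,z\})=\Psi(x)\overline{\Psi(y)}\Psi(z)$ for all $x,y,z\in E_a$ and $\Psi(a)(t)=t$ for all $t\in S$. There is a Gelfand identification of $E_a$ with $\Psi$ isometric, and for every Gelfand identification $(S,\Psi)$ of $E_a$ one has $1\in S$ and $\varphi(x)=\Psi(x)(1)$ for all $x\in E_a$. -/

import Mathlib

open scoped ZeroAtInfty

/-- A (complex) Jordan triple system: a complex vector space with a triple product
`{x, y, z} = tp x y z`, linear and symmetric in the outer variables, conjugate linear in the
middle one, and satisfying the Jordan identity. -/
class JordanTripleSystem (V : Type*) [AddCommGroup V] [Module ℂ V] where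
  /-- The triple product `{x, y, z}`. -/
  tp : V →ₗ[ℂ] V →ₗ⋆[ℂ] V →ₗ[ℂ] V
  tp_symm : ∀ x y z : V, tp x y z = tp z y x
  jordan : ∀ a b x y z : V,
    tp a b (tp x y z) = tp (tp a b x) y z - tp x (tp b a y) z + tp x y (tp a b z)

namespace JordanTripleSystem

/-- The operator `L(a, b) : x ↦ {a, b, x}`. -/
def L {V : Type*} [AddCommGroup V] [Module ℂ V] [JordanTripleSystem V] (a b : V) : V →ₗ[ℂ] V :=
  tp a b

/-- A linear map between Jordan triple systems is a triple homomorphism if it preserves the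
triple products. -/
def IsTripleHom {V W : Type*} [AddCommGroup V] [Module ℂ V] [JordanTripleSystem V]
    [AddCommGroup W] [Module ℂ W] [JordanTripleSystem W] (f : V →ₗ[ℂ] W) : Prop :=
  ∀ x y z : V, f (tp x y z) = tp (f x) (f y) (f z)

/-- The triple product `{x, y, z} = x y* z` on a commutative complex star-algebra. -/
abbrev ofCommStarAlgebra (A : Type*) [NonUnitalCommRing A] [StarRing A] [Module ℂ A]
    [StarModule ℂ A] [IsScalarTower ℂ A A] [SMulCommClass ℂ A A] : JordanTripleSystem A where
  tp :=
    { toFun := fun x =>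
        { toFun := fun y => LinearMap.mulLeft ℂ (x * star y)
          map_add' := by
            intro y y'
            ext z
            simp [mul_add, add_mul, mul_assoc]
          map_smul' := by
            intro c y
            ext z
            simp [star_smul, mul_smul_comm, smul_mul_assoc, mul_assoc] }
      map_add' := by
        intro x x'
        ext y z
        simp [add_mul, mul_assoc]
      map_smul' := by
        intro c x
        ext y z
        simp [smul_mul_assoc, mul_assoc] }
  tp_symm := by
    intro x y z
    change x * star y * z = z * star y * x
    rw [mul_assoc, mul_comm, mul_comm (star y) z]
  jordan := by
    intro a b x y z
    change a * star b * (x * star y * z) =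
      a * star b * x * star y * z - x * star (b * star a * y) * z
        + x * star y * (a * star b * z)
    simp only [star_mul, star_star]
    have h1 : a * star b * (x * star y * z) = a * star b * x * star y * z := by
      simp only [mul_assoc]
    have h2 : x * (star y * (a * star b)) * z = x * star y * (a * star b * z) := by
      simp only [mul_assoc]
    rw [h1, h2, sub_add_cancel]

/-- The triple product `{x, y, z} = x ȳ z` on `ℂ`. -/
noncomputable instance instComplex : JordanTripleSystem ℂ := ofCommStarAlgebra ℂ

/-- The triple product `{f, g, h} = f ḡ h` on `C₀(X)`. -/
noncomputable instance instZeroAtInfty (X : Type*) [TopologicalSpace X] : JordanTripleSystem C₀(X, ℂ) :=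
  ofCommStarAlgebra C₀(X, ℂ)

end JordanTripleSystem

/-- The numerical range `V(X, u, x)` of `x` relative to `u`: the set of the values `Φ x`, where `Φ`
is a functional in the closed unit ball of the dual of `X` with `Φ u = 1`. -/
def numericalRange {X : Type*} [NormedAddCommGroup X] [NormedSpace ℂ X] (u x : X) : Set ℂ :=
  {z | ∃ Φ : X →L[ℂ] ℂ, ‖Φ‖ ≤ 1 ∧ Φ u = 1 ∧ Φ x = z}

/-- A bounded operator is hermitian if its numerical range (relative to the identity, in the
Banach space of bounded operators) is real. -/
def IsHermitianOperator {X : Type*} [NormedAddCommGroup X] [NormedSpace ℂ X]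
    (T : X →L[ℂ] X) : Prop :=
  ∀ z ∈ numericalRange (ContinuousLinearMap.id ℂ X) T, z.im = 0

open JordanTripleSystem in
/-- A JB*-triple: a complex Banach space that is a Jordan triple system, in which every `L(a, a)` is
a (bounded) hermitian operator with non-negative spectrum and `‖{x, x, x}‖ = ‖x‖ ^ 3`. -/
class JBStarTriple (E : Type*) [NormedAddCommGroup E] [NormedSpace ℂ E] [CompleteSpace E]
    extends JordanTripleSystem E where
  hermitian_nonneg : ∀ a : E, ∃ T : E →L[ℂ] E, (T : E →ₗ[ℂ] E) = L a a ∧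
    IsHermitianOperator T ∧ ∀ z ∈ spectrum ℂ T, z.im = 0 ∧ 0 ≤ z.re
  norm_cube : ∀ x : E, ‖tp x x x‖ = ‖x‖ ^ 3

namespace JBStarTriple

open JordanTripleSystem

variable {E : Type*} [NormedAddCommGroup E] [NormedSpace ℂ E] [CompleteSpace E] [JBStarTriple E]

/-- A JB*-subtriple: a norm-closed linear subspace closed under the triple product. -/
def IsSubtriple (M : Submodule ℂ E) : Prop :=
  IsClosed (M : Set E) ∧ ∀ x ∈ M, ∀ y ∈ M, ∀ z ∈ M, tp x y z ∈ M

/-- The JB*-subtriple generated by `a`: the smallest JB*-subtriple containing `a`. -/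
def generated (a : E) : Submodule ℂ E :=
  sInf {M : Submodule ℂ E | IsSubtriple M ∧ a ∈ M}

theorem mem_generated_self (a : E) : a ∈ generated a := by
  rw [generated, Submodule.mem_sInf]
  exact fun M hM => hM.2

theorem isSubtriple_generated (a : E) : IsSubtriple (generated a) := by
  constructor
  · rw [generated, Submodule.coe_sInf]
    exact isClosed_biInter fun M hM => hM.1.1
  · intro x hx y hy z hz
    rw [generated, Submodule.mem_sInf] at *
    exact fun M hM => hM.1.2 x (hx M hM) y (hy M hM) z (hz M hM)

/-- The triple product of `E`, restricted to the JB*-subtriple generated by `a`. -/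
instance instGenerated (a : E) : JordanTripleSystem (generated a) where
  tp :=
    { toFun := fun x =>
        { toFun := fun y => (tp (x : E) (y : E)).restrict
            (fun z hz => (isSubtriple_generated a).2 x x.2 y y.2 z hz)
          map_add' := by
            intro y y'
            ext z
            simp
          map_smul' := by
            intro c y
            ext z
            simp }
      map_add' := by
        intro x x'
        ext y z
        simp
      map_smul' := by
        intro c x
        ext y z
        simp }
  tp_symm := fun x y z => Subtype.ext (JordanTripleSystem.tp_symm (x : E) (y : E) (z : E))
  jordan := fun a' b x y z =>
    Subtype.ext (JordanTripleSystem.jordan (a' : E) (b : E) (x : E) (y : E) (z : E))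

/-- `Ψ` is a Gelfand identification of the JB*-subtriple generated by `a` with `C₀(S)`: here
`S ⊆ (0, ‖a‖]`, `S ∪ {0}` is compact, and `Ψ` is a triple isomorphism (a bijective triple
homomorphism) that maps `a` to the function `t ↦ t` on `S`. -/
def IsGelfand (a : E) (S : Set ℝ) (Ψ : generated a ≃ₗ[ℂ] C₀(S, ℂ)) : Prop :=
  S ⊆ Set.Ioc 0 ‖a‖ ∧ IsCompact (S ∪ {0}) ∧
    IsTripleHom (Ψ : generated a →ₗ[ℂ] C₀(S, ℂ)) ∧
    ∀ t : S, Ψ ⟨a, mem_generated_self a⟩ t = ((t : ℝ) : ℂ)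

end JBStarTriple

/-! The odd powers of `a` multiply like powers, so `x = p(L(a, a)) a` behaves like the odd function
`s ↦ s p(s²)` (`tp_aeval`). The identity `‖{x, x, x}‖ = ‖x‖ ^ 3` gives the norms of infinitely many
odd powers of `x`. Comparing them with powers of `L(x, x)`, as in the spectral radius formula, shows
that `‖x‖²` is the maximum of `|p(t)|² |t|` over the spectrum of `L(a, a)` on the generated
subtriple. With `t = s²` this is the squared supremum norm of `s p(s²)` on the set `S` of positive
square roots of the spectrum. Odd polynomials are dense in `C₀(S)`, and completing gives an
isometric Gelfand identification (`exists_gelfand`).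

For the functional, triple homomorphisms between spaces `C₀` are automatically contractive
(`norm_tripleHom_le`), so every Gelfand identification `Ψ` satisfies `‖x‖ ≤ ‖Ψ x‖`. Hence `Ψ a`, the
function `t ↦ t`, has norm at least `1`, which forces `1 ∈ S`, and `φ ∘ Ψ⁻¹` is a contractive
functional with value `1` at `t ↦ t`. That function has modulus `1` only at `t = 1`, so the
functional is evaluation at `1`, which is a triple homomorphism. -/

open Polynomial JordanTripleSystem

namespace JordanTripleSystem

/-! ### Power associativity and polynomials in one element -/

section Algebra

variable {V : Type*} [AddCommGroup V] [Module ℂ V] [JordanTripleSystem V]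

/-- The operators `L(aᵢ, aⱼ)` on odd powers of `a` depend only on `i + j`. -/
theorem tp_pow_pow (a : V) (n : ℕ) : ∀ i j : ℕ, i + j = n →
    tp ((L a a ^ i) a) ((L a a ^ j) a) = tp ((L a a ^ n) a) a := by
  set u : ℕ → V := fun i => (L a a ^ i) a with hu
  have hu0 : u 0 = a := by simp [hu]
  have hus : ∀ i, tp a a (u i) = u (i + 1) := by
    intro i
    simp only [hu, pow_succ', Module.End.mul_apply]
    rfl
  suffices h : ∀ n i j : ℕ, i + j = n → tp (u i) (u j) = tp (u n) (u 0) by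
    intro i j hij
    simpa only [hu0] using h n i j hij
  intro n
  induction n using Nat.strong_induction_on with
  | _ n ih =>
  rcases n with _ | n
  · intro i j hij
    obtain ⟨rfl, rfl⟩ : i = 0 ∧ j = 0 := by omega
    rfl
  have prod : ∀ i j k, i + j + k ≤ n → tp (u i) (u j) (u k) = u (i + j + k + 1) := by
    intro i j k hk
    rw [ih (i + j) (by omega) i j rfl, tp_symm, ← ih k (by omega) 0 k (by omega), tp_symm,
      ih (i + j + k) (by omega) (i + j) k rfl, tp_symm, hu0, hus]
  have step : ∀ i j : ℕ, ∀ z, tp a a (tp (u i) (u j) z) - tp (u i) (u j) (tp a a z) =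
      tp (u (i + 1)) (u j) z - tp (u i) (u (j + 1)) z := by
    intro i j z
    rw [jordan a a (u i) (u j) z, hus, hus]
    abel
  -- The Jordan identity with the roles of the pairs `(a, a)` and `(u n, u 0)` exchanged: it
  -- evaluates the same commutator, with opposite sign, as the difference of the two extreme
  -- operators.
  have comm : ∀ z, tp (u n) (u 0) (tp a a z) - tp a a (tp (u n) (u 0) z) =
      tp (u (n + 1)) (u 0) z - tp (u 0) (u (n + 1)) z := by
    intro z
    rw [jordan (u n) (u 0) a a z]
    have h1 : tp (u n) (u 0) a = u (n + 1) := by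
      have := prod n 0 0 (by omega)
      rwa [hu0] at this ⊢
    have h2 : tp (u 0) (u n) a = u (n + 1) := by
      have := prod 0 n 0 (by omega)
      rw [hu0] at this ⊢
      simpa using this
    rw [h1, h2, hu0]
    abel
  have delta : ∀ i j : ℕ, i + j = n → ∀ z, tp (u (i + 1)) (u j) z - tp (u i) (u (j + 1)) z =
      tp a a (tp (u n) (u 0) z) - tp (u n) (u 0) (tp a a z) := by
    intro i j hij z
    rw [← step i j z, ih n (by omega) i j hij]
  -- By `delta`, the operators `L(u i, u (n + 1 - i))` form an arithmetic progression in `i` whose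
  -- increment, the commutator of `L(a, a)` and `L(u n, u 0)`, does not depend on `i`.
  have tele : ∀ z, ∀ i ≤ n + 1, tp (u i) (u (n + 1 - i)) z = tp (u 0) (u (n + 1)) z +
      (i : ℂ) • (tp a a (tp (u n) (u 0) z) - tp (u n) (u 0) (tp a a z)) := by
    intro z i
    induction i with
    | zero => simp
    | succ i hi =>
      intro hin
      have e1 := hi (by omega)
      have e2 := delta i (n - i) (by omega) z
      rw [show n - i + 1 = n + 1 - i by omega, e1] at e2
      rw [show n + 1 - (i + 1) = n - i by omega, sub_eq_iff_eq_add.mp e2]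
      push_cast
      module
  -- The total increment over `n + 1` steps is `(n + 1) • d` by `tele` and `-d` by `comm`, so `(n +
  -- 2) • d = 0`.
  have zero : ∀ z, tp a a (tp (u n) (u 0) z) - tp (u n) (u 0) (tp a a z) = 0 := by
    intro z
    have e1 := tele z (n + 1) le_rfl
    have e2 := comm z
    rw [Nat.sub_self] at e1
    set d := tp a a (tp (u n) (u 0) z) - tp (u n) (u 0) (tp a a z) with hd
    have e3 : ((n : ℂ) + 2) • d = 0 := by
      rw [e1, show tp (u n) (u 0) (tp a a z) - tp a a (tp (u n) (u 0) z) = -d by rw [hd]; abel]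
        at e2
      push_cast at e2
      have : ((n : ℂ) + 2) • d = ((n : ℂ) + 1) • d - -d := by module
      rw [this, e2]
      abel
    have hn : ((n : ℂ) + 2) ≠ 0 := by exact_mod_cast (Nat.succ_ne_zero (n + 1))
    exact (smul_eq_zero.mp e3).resolve_left hn
  intro i j hij
  ext z
  have e1 := tele z i (by omega)
  have e2 := tele z (n + 1) le_rfl
  rw [zero z, smul_zero, add_zero] at e1 e2
  rw [Nat.sub_self] at e2
  rw [show j = n + 1 - i by omega, e1, e2]

/-- Power associativity: odd powers of an element multiply like powers. -/
theorem tp_pow_pow_pow (a : V) (i j k : ℕ) :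
    tp ((L a a ^ i) a) ((L a a ^ j) a) ((L a a ^ k) a) = (L a a ^ (i + j + k + 1)) a := by
  have h0 : ∀ n, tp ((L a a ^ n) a) a = tp a ((L a a ^ n) a) := fun n => by
    simpa using (tp_pow_pow a n 0 n (by omega)).symm
  rw [tp_pow_pow a (i + j) i j rfl, tp_symm, h0, tp_symm,
    tp_pow_pow a (i + j + k) (i + j) k rfl, tp_symm, pow_succ', Module.End.mul_apply]
  rfl

/-- By trilinearity this reduces to monomials. The factor `X` reflects `(2i + 1) + (2j + 1) + (2k +
1) = 2(i + j + k + 1) + 1`. -/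
theorem tp_aeval (a : V) (p q r : ℂ[X]) :
    tp (aeval (L a a) p a) (aeval (L a a) q a) (aeval (L a a) r a) =
      aeval (L a a) (p * q.map (starRingEnd ℂ) * r * X) a := by
  induction p using Polynomial.induction_on' with
  | add p p' h h' => simp only [map_add, LinearMap.add_apply, h, h', add_mul]
  | monomial i c =>
  induction q using Polynomial.induction_on' with
  | add p p' h h' =>
    simp only [map_add, LinearMap.add_apply, h, h', add_mul, mul_add, Polynomial.map_add]
  | monomial j d =>
  induction r using Polynomial.induction_on' with
  | add p p' h h' => simp only [map_add, LinearMap.add_apply, h, h', add_mul, mul_add]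
  | monomial k e =>
    rw [Polynomial.map_monomial, ← monomial_one_one_eq_X, monomial_mul_monomial,
      monomial_mul_monomial, monomial_mul_monomial]
    simp only [aeval_monomial, Module.algebraMap_end_eq_smul_id, Module.End.mul_apply,
      LinearMap.smul_apply, LinearMap.id_apply, map_smul, LinearMap.map_smulₛₗ, tp_pow_pow_pow,
      smul_smul]
    congr 1
    ring

end Algebra

/-! ### Boundedness and continuity of the triple product -/

section Norm

variable {V : Type*} [NormedAddCommGroup V] [NormedSpace ℂ V] [JordanTripleSystem V]

theorem tp_polarization (x y : V) :
    (4 : ℂ) • tp x y x = tp (x + y) (x + y) (x + y) - tp (x - y) (x - y) (x - y) +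
      Complex.I • tp (x + Complex.I • y) (x + Complex.I • y) (x + Complex.I • y) -
      Complex.I • tp (x - Complex.I • y) (x - Complex.I • y) (x - Complex.I • y) := by
  have hI : starRingEnd ℂ Complex.I = -Complex.I := Complex.conj_I
  simp only [map_add, map_sub, LinearMap.add_apply, LinearMap.sub_apply, map_smul,
    LinearMap.map_smulₛₗ, LinearMap.smul_apply, smul_add, smul_sub, hI, smul_smul, tp_symm y x x,
    tp_symm y y x, LinearMap.neg_apply, Complex.I_mul_I, neg_smul, one_smul, smul_neg, neg_neg]
  match_scalars <;> ring_nf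
  simp [Complex.I_pow_four]

/-- The triple product is bounded if `‖{x, x, x}‖ = ‖x‖ ^ 3`. -/
theorem norm_tp_le (hcube : ∀ x : V, ‖tp x x x‖ = ‖x‖ ^ 3) (x y z : V) :
    ‖tp x y z‖ ≤ 14 * ‖x‖ * ‖y‖ * ‖z‖ := by
  have h1 : ∀ x y : V, ‖tp x y x‖ ≤ (‖x‖ + ‖y‖) ^ 3 := by
    intro x y
    have hb : ∀ w : V, ‖w‖ ≤ ‖x‖ + ‖y‖ → ‖tp w w w‖ ≤ (‖x‖ + ‖y‖) ^ 3 := fun w hw => by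
      rw [hcube]
      gcongr
    have hIy : ‖Complex.I • y‖ = ‖y‖ := by simp [norm_smul]
    have b1 := hb _ (norm_add_le x y)
    have b2 := hb _ (norm_sub_le x y)
    have b3 := hb _ (hIy ▸ norm_add_le x (Complex.I • y))
    have b4 := hb _ (hIy ▸ norm_sub_le x (Complex.I • y))
    have := congrArg norm (tp_polarization x y)
    rw [norm_smul] at this
    have e : ‖(4 : ℂ)‖ = 4 := by simp
    rw [e] at this
    have t1 := norm_sub_le (tp (x + y) (x + y) (x + y) - tp (x - y) (x - y) (x - y) +
      Complex.I • tp (x + Complex.I • y) (x + Complex.I • y) (x + Complex.I • y))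
      (Complex.I • tp (x - Complex.I • y) (x - Complex.I • y) (x - Complex.I • y))
    have t2 := norm_add_le (tp (x + y) (x + y) (x + y) - tp (x - y) (x - y) (x - y))
      (Complex.I • tp (x + Complex.I • y) (x + Complex.I • y) (x + Complex.I • y))
    have t3 := norm_sub_le (tp (x + y) (x + y) (x + y)) (tp (x - y) (x - y) (x - y))
    rw [norm_smul, Complex.norm_I, one_mul] at t1 t2
    linarith
  -- Polarizing in the outer variables leaves two terms of norm at most `3 ^ 3`, and `2 * 27 / 4 ≤
  -- 14`.
  have h2 : ∀ x y z : V, ‖x‖ = 1 → ‖y‖ = 1 → ‖z‖ = 1 → ‖tp x y z‖ ≤ 14 := by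
    intro x y z hx hy hz
    have e : (4 : ℂ) • tp x y z = tp (x + z) y (x + z) - tp (x - z) y (x - z) := by
      simp only [map_add, map_sub, LinearMap.add_apply, LinearMap.sub_apply, tp_symm z y x]
      module
    have := congrArg norm e
    rw [norm_smul, show ‖(4 : ℂ)‖ = 4 by simp] at this
    have n1 : ‖x + z‖ ≤ 2 := (norm_add_le x z).trans (by linarith)
    have n2 : ‖x - z‖ ≤ 2 := (norm_sub_le x z).trans (by linarith)
    have b1 := (h1 (x + z) y).trans (pow_le_pow_left₀ (by positivity)
      (show ‖x + z‖ + ‖y‖ ≤ 3 by linarith) 3)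
    have b2 := (h1 (x - z) y).trans (pow_le_pow_left₀ (by positivity)
      (show ‖x - z‖ + ‖y‖ ≤ 3 by linarith) 3)
    have := norm_sub_le (tp (x + z) y (x + z)) (tp (x - z) y (x - z))
    linarith
  have key : ∀ w : V, w ≠ 0 → ∃ w' : V, ‖w'‖ = 1 ∧ w = ((‖w‖ : ℝ) : ℂ) • w' := fun w hw => by
    have hn : ((‖w‖ : ℝ) : ℂ) ≠ 0 := by simpa using hw
    refine ⟨((‖w‖ : ℝ) : ℂ)⁻¹ • w, ?_, (smul_inv_smul₀ hn w).symm⟩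
    rw [norm_smul, norm_inv, Complex.norm_real, norm_norm]
    exact inv_mul_cancel₀ (norm_ne_zero_iff.mpr hw)
  rcases eq_or_ne x 0 with rfl | hx
  · simp
  rcases eq_or_ne y 0 with rfl | hy
  · simp
  rcases eq_or_ne z 0 with rfl | hz
  · simp
  obtain ⟨x', hx', ex⟩ := key x hx
  obtain ⟨y', hy', ey⟩ := key y hy
  obtain ⟨z', hz', ez⟩ := key z hz
  have e : tp x y z = (((‖x‖ * ‖y‖ * ‖z‖ : ℝ)) : ℂ) • tp x' y' z' := by
    conv_lhs => rw [ex, ey, ez]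
    simp only [map_smul, LinearMap.map_smulₛₗ, LinearMap.smul_apply, smul_smul, Complex.conj_ofReal]
    congr 1
    push_cast
    ring
  rw [e, norm_smul, Complex.norm_real, Real.norm_of_nonneg (by positivity)]
  have := h2 x' y' z' hx' hy' hz'
  calc ‖x‖ * ‖y‖ * ‖z‖ * ‖tp x' y' z'‖ ≤ ‖x‖ * ‖y‖ * ‖z‖ * 14 := by gcongr
    _ = _ := by ring

theorem continuous_tp (hcube : ∀ x : V, ‖tp x x x‖ = ‖x‖ ^ 3) :
    Continuous fun w : V × V × V => tp w.1 w.2.1 w.2.2 := by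
  rw [continuous_iff_continuousAt]
  rintro ⟨x₀, y₀, z₀⟩
  rw [ContinuousAt, tendsto_iff_norm_sub_tendsto_zero]
  have hb : Filter.Tendsto (fun w : V × V × V => 14 * ‖w.1 - x₀‖ * ‖w.2.1‖ * ‖w.2.2‖ +
      14 * ‖x₀‖ * ‖w.2.1 - y₀‖ * ‖w.2.2‖ + 14 * ‖x₀‖ * ‖y₀‖ * ‖w.2.2 - z₀‖)
      (nhds (x₀, y₀, z₀)) (nhds 0) := by
    have : Continuous (fun w : V × V × V => 14 * ‖w.1 - x₀‖ * ‖w.2.1‖ * ‖w.2.2‖ +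
      14 * ‖x₀‖ * ‖w.2.1 - y₀‖ * ‖w.2.2‖ + 14 * ‖x₀‖ * ‖y₀‖ * ‖w.2.2 - z₀‖) := by fun_prop
    simpa using this.tendsto (x₀, y₀, z₀)
  refine squeeze_zero (fun _ => norm_nonneg _) (fun w => ?_) hb
  have e : tp w.1 w.2.1 w.2.2 - tp x₀ y₀ z₀ = tp (w.1 - x₀) w.2.1 w.2.2 +
      tp x₀ (w.2.1 - y₀) w.2.2 + tp x₀ y₀ (w.2.2 - z₀) := by
    simp only [map_sub, LinearMap.sub_apply]
    abel
  rw [e]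
  exact (norm_add₃_le).trans (add_le_add (add_le_add (norm_tp_le hcube _ _ _)
    (norm_tp_le hcube _ _ _)) (norm_tp_le hcube _ _ _))

end Norm

end JordanTripleSystem

/-! ### Spectra of restrictions to invariant subspaces -/

section Restrict

variable {E : Type*} [NormedAddCommGroup E] [NormedSpace ℂ E]

/-- The algebra of bounded operators that leave a subspace invariant. -/
def invariantOperators (M : Submodule ℂ E) : Subalgebra ℂ (E →L[ℂ] E) where
  carrier := {U | ∀ x ∈ M, U x ∈ M}
  mul_mem' := fun hU hW x hx => hU _ (hW x hx)
  add_mem' := fun hU hW x hx => M.add_mem (hU x hx) (hW x hx)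
  algebraMap_mem' := fun c x hx => by
    simpa [Algebra.algebraMap_eq_smul_one] using M.smul_mem c hx

theorem isClosed_invariantOperators (M : Submodule ℂ E) (hM : IsClosed (M : Set E)) :
    IsClosed (invariantOperators M : Set (E →L[ℂ] E)) := by
  have : (invariantOperators M : Set (E →L[ℂ] E)) = ⋂ x ∈ M, (fun U => U x) ⁻¹' (M : Set E) := by
    ext U
    rw [Set.mem_iInter₂]
    rfl
  rw [this]
  exact isClosed_biInter fun x _ =>
    hM.preimage (ContinuousLinearMap.apply ℂ E x).continuous

/-- Restriction of operators to an invariant subspace. -/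
def invariantOperatorsRestrict (M : Submodule ℂ E) :
    invariantOperators M →ₐ[ℂ] (M →L[ℂ] M) where
  toFun U := (U : E →L[ℂ] E).restrict U.2
  map_one' := rfl
  map_mul' _ _ := rfl
  map_zero' := rfl
  map_add' _ _ := rfl
  commutes' _ := rfl

/-- If the spectrum of an operator is real, the spectrum of its restriction to a closed
invariant subspace is contained in it. -/
theorem spectrum_restrict_subset [CompleteSpace E] (T : E →L[ℂ] E) (hT : ∀ z ∈ spectrum ℂ T, z.im = 0)
    (M : Submodule ℂ E) (hM : IsClosed (M : Set E)) (hTM : ∀ x ∈ M, T x ∈ M) :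
    spectrum ℂ (T.restrict hTM) ⊆ spectrum ℂ T := by
  have hcl := isClosed_invariantOperators M hM
  -- Passing to a closed subalgebra can only fill holes of the spectrum, and a real spectrum has
  -- none: each half of the complement lies between an open half-plane and its closure, and the
  -- halves share a large real number.
  have hconn : IsPreconnected (spectrum ℂ T)ᶜ := by
    suffices h : IsConnected (((spectrum ℂ T)ᶜ ∩ {z | 0 ≤ z.im}) ∪
        (spectrum ℂ T)ᶜ ∩ {z | z.im ≤ 0}) by
      rw [← Set.inter_union_distrib_left] at h
      have e : {z : ℂ | 0 ≤ z.im} ∪ {z | z.im ≤ 0} = Set.univ :=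
        Set.eq_univ_of_forall fun z => le_total 0 z.im
      rw [e, Set.inter_univ] at h
      exact h.isPreconnected
    have hne : ((spectrum ℂ T)ᶜ ∩ {z | 0 ≤ z.im} ∩ ((spectrum ℂ T)ᶜ ∩ {z | z.im ≤ 0})).Nonempty := by
      set r := ‖T‖ * ‖(1 : E →L[ℂ] E)‖
      refine ⟨((|r| + 1 : ℝ) : ℂ), ?_⟩
      have : ((|r| + 1 : ℝ) : ℂ) ∉ spectrum ℂ T := fun h => by
        have h1 := spectrum.norm_le_norm_mul_of_mem h
        rw [Complex.norm_real, Real.norm_of_nonneg (by positivity)] at h1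
        linarith [le_abs_self r]
      have him : ((|r| + 1 : ℝ) : ℂ).im = 0 := Complex.ofReal_im _
      exact ⟨⟨this, him.ge⟩, ⟨this, him.le⟩⟩
    refine IsConnected.union hne ?_ ?_
    · refine Complex.isConnected_of_upperHalfPlane ?_ Set.inter_subset_right
      exact fun z hz => ⟨fun h => (ne_of_gt hz) (hT z h), le_of_lt (α := ℝ) hz⟩
    · refine Complex.isConnected_of_lowerHalfPlane ?_ Set.inter_subset_right
      exact fun z hz => ⟨fun h => (ne_of_lt hz) (hT z h), le_of_lt (α := ℝ) hz⟩
  let T' : invariantOperators M := ⟨T, hTM⟩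
  have h1 : spectrum ℂ T' = spectrum ℂ T :=
    Subalgebra.spectrum_eq_of_isPreconnected_compl (invariantOperators M) T' hconn
  have h2 : spectrum ℂ (invariantOperatorsRestrict M T') ⊆ spectrum ℂ T' :=
    AlgHom.spectrum_apply_subset _ _
  rw [h1] at h2
  exact h2

end Restrict

/-! ### The subtriple generated by one element -/

namespace JBStarTriple

variable {E : Type*} [NormedAddCommGroup E] [NormedSpace ℂ E] [CompleteSpace E] [JBStarTriple E]

instance instCompleteSpaceGenerated (a : E) : CompleteSpace (generated a) :=
  (isSubtriple_generated a).1.completeSpace_coe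

theorem generated_norm_cube (a : E) (x : generated a) : ‖tp x x x‖ = ‖x‖ ^ 3 :=
  norm_cube (x : E)

/-- The operator `L(a, a)` on the subtriple generated by `a` is bounded with non-negative
spectrum. -/
theorem exists_generated_L (a : E) : ∃ T : generated a →L[ℂ] generated a,
    (T : generated a →ₗ[ℂ] generated a) =
      L (⟨a, mem_generated_self a⟩ : generated a) ⟨a, mem_generated_self a⟩ ∧
    ∀ z ∈ spectrum ℂ T, z.im = 0 ∧ 0 ≤ z.re := by
  obtain ⟨T, hT, -, hs⟩ := hermitian_nonneg a
  have hT' : ∀ x, T x = tp a a x := fun x => LinearMap.congr_fun hT x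
  have hM := isSubtriple_generated a
  have hTM : ∀ x ∈ generated a, T x ∈ generated a := fun x hx => by
    rw [hT']
    exact hM.2 a (mem_generated_self a) a (mem_generated_self a) x hx
  refine ⟨T.restrict hTM, ?_, fun z hz => hs z ?_⟩
  · ext x
    exact hT' x
  · exact spectrum_restrict_subset T (fun z hz => (hs z hz).1) _ hM.1 hTM hz

/-- The elements `p(L(a, a)) a`, for polynomials `p`, are dense in the subtriple generated
by `a`. -/
theorem denseRange_aeval_generated (a : E) : DenseRange fun p : ℂ[X] =>
    aeval (L (⟨a, mem_generated_self a⟩ : generated a) ⟨a, mem_generated_self a⟩) p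
      (⟨a, mem_generated_self a⟩ : generated a) := by
  set b : generated a := ⟨a, mem_generated_self a⟩ with hb
  let Q : ℂ[X] →ₗ[ℂ] generated a :=
    (LinearMap.applyₗ b : Module.End ℂ (generated a) →ₗ[ℂ] generated a) ∘ₗ (aeval (L b b)).toLinearMap
  -- The closure of the range is viewed inside `E`, so that minimality of `generated a` applies to
  -- it.
  let M : Submodule ℂ E := ((LinearMap.range Q).topologicalClosure).map (generated a).subtype
  have hcl : IsClosed (M : Set E) := by
    have hemb := (isSubtriple_generated a).1.isClosedEmbedding_subtypeVal
    exact hemb.isClosedMap _ (Submodule.isClosed_topologicalClosure _)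
  have hprod : ∀ x ∈ (LinearMap.range Q).topologicalClosure,
      ∀ y ∈ (LinearMap.range Q).topologicalClosure,
      ∀ z ∈ (LinearMap.range Q).topologicalClosure,
      tp x y z ∈ (LinearMap.range Q).topologicalClosure := by
    intro x hx y hy z hz
    have hc := continuous_tp (V := generated a) (generated_norm_cube a)
    have hmem : (x, y, z) ∈ closure ((LinearMap.range Q : Set (generated a)) ×ˢ
        ((LinearMap.range Q : Set (generated a)) ×ˢ (LinearMap.range Q : Set (generated a)))) := by
      rw [closure_prod_eq, closure_prod_eq]
      exact ⟨hx, hy, hz⟩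
    refine map_mem_closure (f := fun w : generated a × generated a × generated a =>
      tp w.1 w.2.1 w.2.2) hc hmem ?_
    rintro ⟨x, y, z⟩ ⟨⟨p, rfl⟩, ⟨q, rfl⟩, ⟨r, rfl⟩⟩
    exact ⟨_, (tp_aeval b p q r).symm⟩
  have hsub : IsSubtriple M := by
    refine ⟨hcl, ?_⟩
    rintro _ ⟨x, hx, rfl⟩ _ ⟨y, hy, rfl⟩ _ ⟨z, hz, rfl⟩
    exact ⟨tp x y z, hprod x hx y hy z hz, rfl⟩
  have haM : a ∈ M := ⟨b, subset_closure ⟨1, by simp [Q]⟩, rfl⟩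
  intro x
  have hxM : (x : E) ∈ M := (Submodule.mem_sInf.mp x.2) M ⟨hsub, haM⟩
  obtain ⟨y, hy, hyx⟩ := hxM
  have : y = x := Subtype.ext hyx
  subst this
  exact hy

end JBStarTriple

/-- The constant `K` disappears under `m`-th roots. Infinitely many exponents suffice, which matters
because the cube identity controls only a sparse set of them. -/
theorem le_of_frequently_pow_le {u c K : ℝ} (hu : 0 ≤ u) (hc : 0 ≤ c)
    (h : ∃ᶠ m in Filter.atTop, u ^ m ≤ K * c ^ m) : u ≤ c := by
  by_contra! hcu
  have hu0 : 0 < u := hc.trans_lt hcu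
  have ht : Filter.Tendsto (fun m : ℕ => K * (c / u) ^ m) Filter.atTop (nhds 0) := by
    simpa using (tendsto_pow_atTop_nhds_zero_of_lt_one (div_nonneg hc hu)
      ((div_lt_one hu0).mpr hcu)).const_mul K
  obtain ⟨m, h1, h2⟩ := (h.and_eventually (ht.eventually_lt_const one_pos)).exists
  rw [div_pow, ← mul_div_assoc, div_lt_one (by positivity)] at h2
  exact absurd h1 (not_le.mpr h2)

/-! ### Norms of polynomials in one element and the spectrum -/

section Calculus

variable {V : Type*} [NormedAddCommGroup V] [NormedSpace ℂ V] [JordanTripleSystem V]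

theorem coe_aeval_clm {T : V →L[ℂ] V} {a : V} (hT : (T : V →ₗ[ℂ] V) = L a a) (p : ℂ[X]) :
    ((aeval T p : V →L[ℂ] V) : V →ₗ[ℂ] V) = aeval (L a a) p := by
  rw [← hT]
  let F : (V →L[ℂ] V) →ₐ[ℂ] (V →ₗ[ℂ] V) :=
    { ContinuousLinearMap.toLinearMapRingHom with commutes' := fun _ => rfl }
  exact (aeval_algHom_apply F T p).symm

theorem aeval_clm_apply {T : V →L[ℂ] V} {a : V} (hT : (T : V →ₗ[ℂ] V) = L a a) (p : ℂ[X]) (x : V) :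
    (aeval T p : V →L[ℂ] V) x = aeval (L a a) p x :=
  LinearMap.congr_fun (coe_aeval_clm hT p) x

/-- For `x = p(L(a, a)) a`, the operator `L(x, x)` is `(p * conj p * X)(L(a, a))` on the subtriple
generated by `a`. -/
noncomputable def squarePoly (p : ℂ[X]) : ℂ[X] := p * p.map (starRingEnd ℂ) * X

theorem squarePoly_map_conj (p : ℂ[X]) :
    (squarePoly p).map (starRingEnd ℂ) = squarePoly p := by
  have : (p.map (starRingEnd ℂ)).map (starRingEnd ℂ) = p := by
    rw [Polynomial.map_map]
    simp
  simp only [squarePoly, Polynomial.map_mul, this, Polynomial.map_X]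
  ring

theorem eval_map_conj_ofReal (p : ℂ[X]) (t : ℝ) :
    (p.map (starRingEnd ℂ)).eval (t : ℂ) = starRingEnd ℂ (p.eval (t : ℂ)) := by
  conv_lhs => rw [← Complex.conj_ofReal t]
  rw [eval_map, eval₂_hom]

theorem norm_eval_squarePoly (p : ℂ[X]) (t : ℝ) :
    ‖(squarePoly p).eval (t : ℂ)‖ = ‖p.eval (t : ℂ)‖ ^ 2 * |t| := by
  simp only [squarePoly, eval_mul, eval_X, eval_map_conj_ofReal, norm_mul, RCLike.norm_conj,
    Complex.norm_real, Real.norm_eq_abs]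
  ring

theorem tp_squarePoly_pow (a : V) (p : ℂ[X]) (i j k : ℕ) :
    tp (aeval (L a a) (p * squarePoly p ^ i) a) (aeval (L a a) (p * squarePoly p ^ j) a)
      (aeval (L a a) (p * squarePoly p ^ k) a) =
    aeval (L a a) (p * squarePoly p ^ (i + j + k + 1)) a := by
  rw [tp_aeval, Polynomial.map_mul, Polynomial.map_pow, squarePoly_map_conj]
  congr 2
  simp only [squarePoly]
  ring

/-- Repeated cubing: the step `m ↦ 3m + 1` triples the exponent, since `2(3m + 1) + 1 = 3(2m + 1)`.
-/
theorem frequently_norm_squarePoly_pow (hcube : ∀ x : V, ‖tp x x x‖ = ‖x‖ ^ 3) (a : V) (p : ℂ[X]) :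
    ∃ᶠ m in Filter.atTop, ‖aeval (L a a) (p * squarePoly p ^ m) a‖ =
      ‖aeval (L a a) p a‖ ^ (2 * m + 1) := by
  rw [Filter.frequently_atTop]
  intro n
  induction n with
  | zero => exact ⟨0, le_rfl, by simp⟩
  | succ n ih =>
    obtain ⟨m, hm, h⟩ := ih
    refine ⟨m + m + m + 1, by omega, ?_⟩
    rw [← tp_squarePoly_pow, hcube, h]
    ring

theorem continuous_tp_right (hcube : ∀ x : V, ‖tp x x x‖ = ‖x‖ ^ 3) (x y : V) :
    Continuous (tp x y) :=
  AddMonoidHomClass.continuous_of_bound (tp x y) (14 * ‖x‖ * ‖y‖) (norm_tp_le hcube x y)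

/-- Both sides are continuous in `y` and agree on the dense set of elements `q(L(a, a)) a`. This
bounds powers of an operator by norms of elements. -/
theorem squarePoly_pow_apply (hcube : ∀ x : V, ‖tp x x x‖ = ‖x‖ ^ 3) {a : V} {T : V →L[ℂ] V}
    (hT : (T : V →ₗ[ℂ] V) = L a a) (hd : DenseRange fun p : ℂ[X] => aeval (L a a) p a)
    (p : ℂ[X]) (m : ℕ) (y : V) :
    (aeval T (squarePoly p) ^ (m + 1)) y =
      tp (aeval (L a a) (p * squarePoly p ^ m) a) (aeval (L a a) p a) y := by
  rw [← map_pow]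
  have hc := continuous_tp_right hcube (aeval (L a a) (p * squarePoly p ^ m) a) (aeval (L a a) p a)
  refine congrFun (hd.equalizer (aeval T (squarePoly p ^ (m + 1)) : V →L[ℂ] V).continuous hc ?_) y
  ext q
  · simp only [Function.comp_apply]
    rw [aeval_clm_apply hT, tp_aeval, ← Module.End.mul_apply, ← map_mul]
    have e : squarePoly p ^ (m + 1) * q =
        p * squarePoly p ^ m * p.map (starRingEnd ℂ) * q * X := by
      rw [pow_succ]
      nth_rw 2 [squarePoly]
      ring
    rw [e]

variable [CompleteSpace V]

/-- Spectral mapping puts the value `μ` of `squarePoly p` at `t` in the spectrum of `U`. Powers of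
`μ` are bounded by `‖U ^ (m + 1)‖`, hence by `14 * (‖x‖ ^ 2) ^ (m + 1)` for infinitely many `m`. -/
theorem norm_eval_le_of_mem_spectrum (hcube : ∀ x : V, ‖tp x x x‖ = ‖x‖ ^ 3) {a : V}
    {T : V →L[ℂ] V} (hT : (T : V →ₗ[ℂ] V) = L a a)
    (hd : DenseRange fun p : ℂ[X] => aeval (L a a) p a) (p : ℂ[X]) {t : ℝ}
    (ht : (t : ℂ) ∈ spectrum ℂ T) :
    ‖p.eval (t : ℂ)‖ ^ 2 * |t| ≤ ‖aeval (L a a) p a‖ ^ 2 := by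
  rcases subsingleton_or_nontrivial V with hV | hV
  · have : Subsingleton (V →L[ℂ] V) := ⟨fun f g => by ext x; exact Subsingleton.elim _ _⟩
    simp [spectrum.of_subsingleton] at ht
  rw [← norm_eval_squarePoly]
  set U := aeval T (squarePoly p) with hU
  set x := aeval (L a a) p a with hx
  have hμ : (squarePoly p).eval (t : ℂ) ∈ spectrum ℂ U := by
    rw [hU, spectrum.map_polynomial_aeval]
    exact ⟨_, ht, rfl⟩
  set μ := (squarePoly p).eval (t : ℂ)
  have hb : ∃ᶠ m in Filter.atTop, ‖μ‖ ^ (m + 1) ≤ 14 * (‖x‖ ^ 2) ^ (m + 1) := by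
    refine (frequently_norm_squarePoly_pow hcube a p).mono fun m hm => ?_
    have h1 := spectrum.norm_le_norm_of_mem (spectrum.pow_mem_pow U (m + 1) hμ)
    rw [norm_pow] at h1
    refine h1.trans (ContinuousLinearMap.opNorm_le_bound _ (by positivity) fun y => ?_)
    rw [squarePoly_pow_apply hcube hT hd]
    refine (norm_tp_le hcube _ _ _).trans_eq ?_
    rw [hm]
    ring
  exact le_of_frequently_pow_le (norm_nonneg _) (sq_nonneg _)
    ((Filter.tendsto_add_atTop_nat 1).frequently hb)

/-- Applying `U ^ m` to `x` gives an odd power of `x`, so `‖x‖ ^ (2 * m) ≤ ‖U ^ m‖` for infinitely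
many `m`. Gelfand's formula then bounds `‖x‖ ^ 2` by the spectral radius of `U`, which is attained
in the spectrum. -/
theorem exists_mem_spectrum_norm_le (hcube : ∀ x : V, ‖tp x x x‖ = ‖x‖ ^ 3) {a : V} (ha : a ≠ 0)
    {T : V →L[ℂ] V} (hT : (T : V →ₗ[ℂ] V) = L a a) (hs : ∀ z ∈ spectrum ℂ T, z.im = 0)
    (p : ℂ[X]) :
    ∃ t : ℝ, (t : ℂ) ∈ spectrum ℂ T ∧ ‖aeval (L a a) p a‖ ^ 2 ≤ ‖p.eval (t : ℂ)‖ ^ 2 * |t| := by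
  have : Nontrivial V := ⟨a, 0, ha⟩
  set U := aeval T (squarePoly p) with hU
  set x := aeval (L a a) p a with hx
  obtain ⟨μ, hμ, hr⟩ := spectrum.exists_nnnorm_eq_spectralRadius U
  have hle : (‖x‖₊ ^ 2 : NNReal) ≤ ‖μ‖₊ := by
    rcases eq_or_ne x 0 with h0 | h0
    · simp [h0]
    rw [← ENNReal.coe_le_coe, hr]
    refine ge_of_tendsto_of_frequently
      (spectrum.pow_nnnorm_pow_one_div_tendsto_nhds_spectralRadius U) ?_
    refine ((frequently_norm_squarePoly_pow hcube a p).and_eventually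
      (Filter.eventually_ge_atTop 1)).mono ?_
    rintro m ⟨hm, hm1⟩
    have h1 : ‖x‖₊ ^ (2 * m + 1) ≤ ‖U ^ m‖₊ * ‖x‖₊ := by
      have h2 := (U ^ m).le_opNorm x
      have h3 : (U ^ m) x = aeval (L a a) (p * squarePoly p ^ m) a := by
        rw [hU, ← map_pow, aeval_clm_apply hT, hx, ← Module.End.mul_apply, ← map_mul, mul_comm]
      rw [h3, hm] at h2
      exact h2
    have h4 : (‖x‖₊ ^ 2) ^ m ≤ ‖U ^ m‖₊ := by
      have hx0 : 0 < ‖x‖₊ := nnnorm_pos.mpr h0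
      rw [pow_succ, pow_mul] at h1
      exact le_of_mul_le_mul_right h1 hx0
    calc ((‖x‖₊ ^ 2 : NNReal) : ENNReal)
        = (((‖x‖₊ ^ 2 : NNReal) : ENNReal) ^ m) ^ (1 / m : ℝ) := by
          rw [one_div, ENNReal.pow_rpow_inv_natCast (by omega)]
      _ ≤ _ := by
          refine ENNReal.rpow_le_rpow ?_ (by positivity)
          exact_mod_cast h4
  rw [hU, spectrum.map_polynomial_aeval] at hμ
  obtain ⟨z, hz, rfl⟩ := hμ
  have hz' : z = (z.re : ℂ) := Complex.ext rfl (hs z hz)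
  refine ⟨z.re, hz' ▸ hz, ?_⟩
  rw [← norm_eval_squarePoly, ← hz']
  exact_mod_cast hle

end Calculus

/-! ### Density of odd polynomials in `C₀(S)` -/

section OddPolynomials

variable {S : Set ℝ}

theorem tendsto_cocompact_of_isCompact_union_zero (hK : IsCompact (S ∪ {0})) {F : ℝ → ℂ}
    (hF : Continuous F) (hF0 : F 0 = 0) :
    Filter.Tendsto (fun s : S => F s) (Filter.cocompact S) (nhds 0) := by
  rw [Metric.tendsto_nhds]
  intro ε hε
  rw [Filter.Eventually, Filter.mem_cocompact]
  refine ⟨{s : S | ε ≤ ‖F s‖}, ?_, fun s hs => by simpa using hs⟩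
  rw [Subtype.isCompact_iff]
  have e : (Subtype.val '' {s : S | ε ≤ ‖F s‖} : Set ℝ) = (S ∪ {0}) ∩ {s | ε ≤ ‖F s‖} := by
    ext s
    constructor
    · rintro ⟨s, hs, rfl⟩
      exact ⟨Or.inl s.2, hs⟩
    · rintro ⟨hs | hs, h⟩
      · exact ⟨⟨s, hs⟩, h, rfl⟩
      · rw [Set.mem_singleton_iff.mp hs] at h
        simp only [Set.mem_ofPred_eq, hF0, norm_zero] at h
        exact absurd h (not_le.mpr hε)
  rw [e]
  exact hK.inter_right (isClosed_le continuous_const hF.norm)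

/-- The odd polynomial functions `s ↦ s p(s²)` on `S`, as functions vanishing at infinity. -/
noncomputable def oddPolynomial (hK : IsCompact (S ∪ {0})) : ℂ[X] →ₗ[ℂ] C₀(S, ℂ) where
  toFun p :=
    { toFun := fun s => ((s : ℝ) : ℂ) * p.eval (((s : ℝ) : ℂ) ^ 2)
      continuous_toFun := by fun_prop
      zero_at_infty' := tendsto_cocompact_of_isCompact_union_zero hK
        (F := fun s => (s : ℂ) * p.eval ((s : ℂ) ^ 2)) (by fun_prop) (by simp) }
  map_add' p q := by
    ext s
    simp [mul_add]
  map_smul' c p := by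
    ext s
    simp [mul_left_comm]

theorem oddPolynomial_apply (hK : IsCompact (S ∪ {0})) (p : ℂ[X]) (s : S) :
    oddPolynomial hK p s = ((s : ℝ) : ℂ) * p.eval (((s : ℝ) : ℂ) ^ 2) := rfl

open Classical in
/-- A function vanishing at infinity on `S ⊆ (0, ∞)` extends by zero to a continuous function on
`S ∪ {0}`. -/
theorem exists_extend_zero (hS : S ⊆ Set.Ioi 0) (g : C₀(S, ℂ)) :
    ∃ G : C(↥(S ∪ {0}), ℂ), (∀ (s : ↥(S ∪ {0})) (hs : (s : ℝ) ∈ S), G s = g ⟨s, hs⟩) ∧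
      ∀ s : ↥(S ∪ {0}), (s : ℝ) = 0 → G s = 0 := by
  set G : ↥(S ∪ {0}) → ℂ := fun s => if hs : (s : ℝ) ∈ S then g ⟨s, hs⟩ else 0 with hG
  have h1 : ∀ (s : ↥(S ∪ {0})) (hs : (s : ℝ) ∈ S), G s = g ⟨s, hs⟩ := fun s hs => by
    simp [hG, hs]
  have h0 : ∀ s : ↥(S ∪ {0}), (s : ℝ) = 0 → G s = 0 := fun s hs => by
    have : (s : ℝ) ∉ S := fun h => lt_irrefl _ (hs ▸ Set.mem_Ioi.mp (hS h))
    simp [hG, this]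
  refine ⟨⟨G, continuous_iff_continuousAt.mpr fun s => ?_⟩, h1, h0⟩
  rcases s.2 with hs | hs
  · let ι : S → ↥(S ∪ {0}) := Set.inclusion Set.subset_union_left
    have hopen : IsOpen (Set.range ι) := by
      have : Set.range ι = (Subtype.val : ↥(S ∪ {0}) → ℝ) ⁻¹' Set.Ioi 0 := by
        ext x
        constructor
        · rintro ⟨y, rfl⟩
          exact hS y.2
        · intro hx
          rcases x.2 with h | h
          · exact ⟨⟨x, h⟩, rfl⟩
          · exact absurd (Set.mem_singleton_iff.mp h) (ne_of_gt hx)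
      rw [this]
      exact isOpen_Ioi.preimage continuous_subtype_val
    have hemb : Topology.IsOpenEmbedding ι := ⟨.inclusion Set.subset_union_left, hopen⟩
    have : ContinuousAt (G ∘ ι) ⟨s, hs⟩ := by
      have e : G ∘ ι = g := funext fun y => h1 (ι y) y.2
      rw [e]
      exact g.continuous.continuousAt
    exact hemb.continuousAt_iff.mp this
  -- Off a compact subset of `S` the function `g` is smaller than `ε`; that subset is closed in `ℝ`
  -- and misses `0`.
  · rw [ContinuousAt, h0 s hs, Metric.tendsto_nhds]
    intro ε hε
    have hg := (Metric.tendsto_nhds.mp g.zero_at_infty') ε hε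
    rw [Filter.Eventually, Filter.mem_cocompact] at hg
    obtain ⟨t, ht, hts⟩ := hg
    have hcl : IsClosed (Subtype.val '' t : Set ℝ) := (Subtype.isCompact_iff.mp ht).isClosed
    have hmem : (s : ℝ) ∈ (Subtype.val '' t : Set ℝ)ᶜ := by
      rintro ⟨y, -, hy⟩
      have := hS y.2
      rw [hy, Set.mem_singleton_iff.mp hs] at this
      exact lt_irrefl _ (Set.mem_Ioi.mp this)
    filter_upwards [continuous_subtype_val.continuousAt.eventually_mem
      (hcl.isOpen_compl.mem_nhds hmem)] with x hx
    rcases x.2 with h | h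
    · rw [h1 x h]
      refine hts (fun hxt => hx ⟨_, hxt, rfl⟩ : (⟨x, h⟩ : S) ∈ tᶜ)
    · rw [h0 x h, dist_self]
      exact hε

/-- Even polynomial functions are dense on a compact set of non-negative real numbers. -/
theorem exists_even_polynomial_near {K : Set ℝ} (hK : IsCompact K) (hK0 : K ⊆ Set.Ici 0)
    (h : C(K, ℂ)) {ε : ℝ} (hε : 0 < ε) :
    ∃ p : ℂ[X], ∀ s : K, ‖h s - p.eval (((s : ℝ) : ℂ) ^ 2)‖ < ε := by
  have : CompactSpace K := isCompact_iff_compactSpace.mp hK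
  let q : C(K, ℂ) := ⟨fun s => ((s : ℝ) : ℂ) ^ 2, by fun_prop⟩
  have hev : ∀ (p : ℂ[X]) (s : K), aeval q p s = p.eval (((s : ℝ) : ℂ) ^ 2) := fun p s => by
    have := (aeval_algHom_apply (ContinuousMap.evalAlgHom ℂ ℂ s) q p).symm
    rw [coe_aeval_eq_eval] at this
    exact this
  let A : StarSubalgebra ℂ C(K, ℂ) :=
    { (aeval q : ℂ[X] →ₐ[ℂ] C(K, ℂ)).range with
      star_mem' := by
        rintro _ ⟨p, rfl⟩
        refine ⟨p.map (starRingEnd ℂ), ?_⟩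
        ext s
        change aeval q (p.map (starRingEnd ℂ)) s = star (aeval q p s)
        rw [hev, hev, ← Complex.ofReal_pow, eval_map_conj_ofReal]
        rfl }
  have hA : A.SeparatesPoints := by
    intro s t hst
    refine ⟨q, ⟨q, ⟨X, aeval_X q⟩, rfl⟩, fun h => hst ?_⟩
    have h' : (((s : ℝ)) : ℂ) ^ 2 = ((t : ℝ) : ℂ) ^ 2 := h
    have h'' : (s : ℝ) ^ 2 = (t : ℝ) ^ 2 := by exact_mod_cast h'
    exact Subtype.ext ((sq_eq_sq₀ (hK0 s.2) (hK0 t.2)).mp h'')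
  have htop := ContinuousMap.starSubalgebra_topologicalClosure_eq_top_of_separatesPoints A hA
  have hmem : h ∈ A.topologicalClosure := htop ▸ StarSubalgebra.mem_top
  obtain ⟨_, ⟨p, rfl⟩, hp⟩ := Metric.mem_closure_iff.mp hmem ε hε
  refine ⟨p, fun s => ?_⟩
  have := (ContinuousMap.dist_apply_le_dist s).trans_lt hp
  rw [dist_eq_norm] at this
  rw [← hev]
  exact this

/-- The extension of `g` by zero is nearly `s * h(s)` with `h` continuous, and `h` is nearly an even
polynomial. Since `0 < s ≤ 1` on `S`, multiplying by `s` does not enlarge the second error. -/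
theorem denseRange_oddPolynomial (hS : S ⊆ Set.Ioc 0 1) (hK : IsCompact (S ∪ {0})) :
    DenseRange (oddPolynomial hK) := by
  intro g
  rw [Metric.mem_closure_iff]
  intro ε hε
  have : CompactSpace ↥(S ∪ {0}) := isCompact_iff_compactSpace.mp hK
  obtain ⟨G, hG, hG0⟩ := exists_extend_zero (fun s hs => (hS hs).1) g
  let i : C(↥(S ∪ {0}), ℂ) := ⟨fun s => ((s : ℝ) : ℂ), by fun_prop⟩
  -- A closed ideal of continuous functions on a compact space is determined by its common zeros;
  -- here the only zero of `i` is `0`, where `G` vanishes.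
  have hGi : G ∈ (Ideal.span {i}).closure := by
    rw [← ContinuousMap.idealOfSet_ofIdeal_eq_closure, ContinuousMap.mem_idealOfSet]
    intro s hs
    refine hG0 s ?_
    have := ContinuousMap.notMem_setOfIdeal.mp hs (Ideal.mem_span_singleton_self i)
    exact Complex.ofReal_eq_zero.mp this
  obtain ⟨_, hmem, hd⟩ := Metric.mem_closure_iff.mp hGi (ε / 4) (by positivity)
  obtain ⟨h, rfl⟩ := Ideal.mem_span_singleton'.mp hmem
  have hK0 : S ∪ {0} ⊆ Set.Ici 0 := by
    rintro s (hs | hs)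
    · exact (hS hs).1.le
    · exact (Set.mem_singleton_iff.mp hs).ge
  obtain ⟨p, hp⟩ := exists_even_polynomial_near hK hK0 h (show 0 < ε / 4 by positivity)
  refine ⟨oddPolynomial hK p, ⟨p, rfl⟩, ?_⟩
  refine lt_of_le_of_lt (b := ε / 2) ?_ (by linarith)
  rw [dist_eq_norm, ← ZeroAtInftyContinuousMap.norm_toBCF_eq_norm,
    BoundedContinuousFunction.norm_le (by positivity)]
  intro s
  change ‖g s - ((s : ℝ) : ℂ) * p.eval (((s : ℝ) : ℂ) ^ 2)‖ ≤ ε / 2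
  let s' : ↥(S ∪ {0}) := ⟨s, Or.inl s.2⟩
  have h1 : ‖g s - h s' * ((s : ℝ) : ℂ)‖ < ε / 4 := by
    have := (ContinuousMap.dist_apply_le_dist s').trans_lt hd
    rw [dist_eq_norm, hG s' s.2] at this
    exact this
  have h2 : ‖((s : ℝ) : ℂ) * (h s' - p.eval (((s : ℝ) : ℂ) ^ 2))‖ ≤ ε / 4 := by
    rw [norm_mul, Complex.norm_real, Real.norm_of_nonneg (hS s.2).1.le]
    calc (s : ℝ) * ‖h s' - p.eval (((s : ℝ) : ℂ) ^ 2)‖ ≤ 1 * (ε / 4) :=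
          mul_le_mul (hS s.2).2 (hp s').le (norm_nonneg _) zero_le_one
      _ = ε / 4 := one_mul _
  calc ‖g s - ((s : ℝ) : ℂ) * p.eval (((s : ℝ) : ℂ) ^ 2)‖
      = ‖(g s - h s' * ((s : ℝ) : ℂ)) +
          ((s : ℝ) : ℂ) * (h s' - p.eval (((s : ℝ) : ℂ) ^ 2))‖ := by ring_nf
    _ ≤ ε / 2 := (norm_add_le _ _).trans (by linarith)

end OddPolynomials

/-! ### The supremum norm and the Gelfand representation -/

theorem norm_apply_le_zeroAtInfty {X : Type*} [TopologicalSpace X] (f : C₀(X, ℂ)) (x : X) :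
    ‖f x‖ ≤ ‖f‖ := by
  rw [← ZeroAtInftyContinuousMap.norm_toBCF_eq_norm]
  exact f.toBCF.norm_coe_le_norm x

theorem norm_le_zeroAtInfty {X : Type*} [TopologicalSpace X] (f : C₀(X, ℂ)) {C : ℝ} (hC : 0 ≤ C)
    (h : ∀ x, ‖f x‖ ≤ C) : ‖f‖ ≤ C := by
  rw [← ZeroAtInftyContinuousMap.norm_toBCF_eq_norm, BoundedContinuousFunction.norm_le hC]
  exact h

section Gelfand

variable {V : Type*} [NormedAddCommGroup V] [NormedSpace ℂ V]

/-- The positive square roots of the elements of the spectrum of an operator. -/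
def sqrtSpectrum (T : V →L[ℂ] V) : Set ℝ := {s | 0 < s ∧ ((s ^ 2 : ℝ) : ℂ) ∈ spectrum ℂ T}

theorem isCompact_sqrtSpectrum_union_zero [CompleteSpace V] {T : V →L[ℂ] V}
    (hS : sqrtSpectrum T ⊆ Set.Ioc 0 1) : IsCompact (sqrtSpectrum T ∪ {0}) := by
  -- Adjoining `0` allows `0 < s` to be relaxed to the closed condition `0 ≤ s`.
  have e : sqrtSpectrum T ∪ {0} =
      (Set.Icc 0 1 ∩ (fun s : ℝ => ((s ^ 2 : ℝ) : ℂ)) ⁻¹' spectrum ℂ T) ∪ {0} := by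
    ext s
    constructor
    · rintro (h | h)
      · exact Or.inl ⟨⟨h.1.le, (hS h).2⟩, h.2⟩
      · exact Or.inr h
    · rintro (h | h)
      · rcases h.1.1.eq_or_lt with h0 | h0
        · exact Or.inr h0.symm
        · exact Or.inl ⟨h0, h.2⟩
      · exact Or.inr h
  rw [e]
  exact (isCompact_Icc.inter_right ((spectrum.isClosed T).preimage (by fun_prop))).union
    isCompact_singleton

variable [JordanTripleSystem V]

/-- The map `p ↦ p(L(a, a)) a`. -/
noncomputable def oddPower (a : V) : ℂ[X] →ₗ[ℂ] V :=
  (LinearMap.applyₗ a : Module.End ℂ V →ₗ[ℂ] V) ∘ₗ (aeval (L a a)).toLinearMap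

theorem oddPower_apply (a : V) (p : ℂ[X]) : oddPower a p = aeval (L a a) p a := rfl

/-- Continuity and density reduce this to polynomials. There the factor `X` in `tp_aeval` becomes
`s²`, which supplies the two factors `s` missing from `s * s * s`. -/
theorem isTripleHom_of_oddPower {S : Set ℝ} (hK : IsCompact (S ∪ {0}))
    (hcube : ∀ x : V, ‖tp x x x‖ = ‖x‖ ^ 3) {a : V} (hd : DenseRange (oddPower a))
    (Ψ : V ≃ₗᵢ[ℂ] C₀(S, ℂ)) (hΨ : ∀ p, Ψ (oddPower a p) = oddPolynomial hK p) :
    IsTripleHom (Ψ.toLinearEquiv : V →ₗ[ℂ] C₀(S, ℂ)) := by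
  have hc1 : Continuous fun w : V × V × V => Ψ (tp w.1 w.2.1 w.2.2) :=
    Ψ.continuous.comp (continuous_tp hcube)
  have hc2 : Continuous fun w : V × V × V => Ψ w.1 * star (Ψ w.2.1) * Ψ w.2.2 := by
    have := Ψ.continuous
    fun_prop
  have hpoly : ∀ p q r, Ψ (tp (oddPower a p) (oddPower a q) (oddPower a r)) =
      Ψ (oddPower a p) * star (Ψ (oddPower a q)) * Ψ (oddPower a r) := by
    intro p q r
    rw [oddPower_apply, oddPower_apply, oddPower_apply, tp_aeval]
    simp only [← oddPower_apply]
    rw [hΨ, hΨ, hΨ, hΨ]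
    ext s
    rw [ZeroAtInftyContinuousMap.mul_apply, ZeroAtInftyContinuousMap.mul_apply,
      ZeroAtInftyContinuousMap.star_apply, RCLike.star_def]
    simp only [oddPolynomial_apply, eval_mul, eval_X, map_mul, Complex.conj_ofReal,
      ← Complex.ofReal_pow, eval_map_conj_ofReal]
    push_cast
    ring
  have := (hd.prodMap (hd.prodMap hd)).equalizer hc1 hc2
    (funext fun w => hpoly w.1 w.2.1 w.2.2)
  intro x y z
  exact congrFun this (x, y, z)

variable [CompleteSpace V]

theorem sqrtSpectrum_subset_Ioc (hcube : ∀ x : V, ‖tp x x x‖ = ‖x‖ ^ 3) {a : V} (ha : ‖a‖ = 1)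
    {T : V →L[ℂ] V} (hT : (T : V →ₗ[ℂ] V) = L a a)
    (hd : DenseRange fun p : ℂ[X] => aeval (L a a) p a) : sqrtSpectrum T ⊆ Set.Ioc 0 1 := by
  intro s hs
  refine ⟨hs.1, ?_⟩
  have h := norm_eval_le_of_mem_spectrum hcube hT hd 1 hs.2
  rw [eval_one, norm_one, one_pow, one_mul, map_one, Module.End.one_apply, ha, one_pow,
    abs_of_nonneg (sq_nonneg s)] at h
  exact (sq_le_one_iff₀ hs.1.le).mp h

/-- The two spectral estimates match under `t = s²`. The spectral value `t = 0` has no counterpart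
in `sqrtSpectrum T`, but there the bound `|p(t)|² |t|` is zero. -/
theorem norm_oddPolynomial (hcube : ∀ x : V, ‖tp x x x‖ = ‖x‖ ^ 3) {a : V} (ha : a ≠ 0)
    {T : V →L[ℂ] V} (hT : (T : V →ₗ[ℂ] V) = L a a)
    (hs : ∀ z ∈ spectrum ℂ T, z.im = 0 ∧ 0 ≤ z.re)
    (hd : DenseRange fun p : ℂ[X] => aeval (L a a) p a)
    (hK : IsCompact (sqrtSpectrum T ∪ {0})) (p : ℂ[X]) :
    ‖oddPolynomial hK p‖ = ‖aeval (L a a) p a‖ := by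
  have hsq : ∀ s : sqrtSpectrum T, ‖oddPolynomial hK p s‖ ^ 2 =
      ‖p.eval (((s : ℝ) ^ 2 : ℝ) : ℂ)‖ ^ 2 * |(s : ℝ) ^ 2| := fun s => by
    rw [oddPolynomial_apply, norm_mul, Complex.norm_real, mul_pow, Real.norm_eq_abs, sq_abs,
      abs_of_nonneg (sq_nonneg _), Complex.ofReal_pow, mul_comm]
  apply le_antisymm
  · refine norm_le_zeroAtInfty _ (norm_nonneg _) fun s => ?_
    refine (sq_le_sq₀ (norm_nonneg _) (norm_nonneg _)).mp ?_
    rw [hsq]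
    exact norm_eval_le_of_mem_spectrum hcube hT hd p s.2.2
  · obtain ⟨t, ht, h⟩ := exists_mem_spectrum_norm_le hcube ha hT (fun z hz => (hs z hz).1) p
    have ht0 : 0 ≤ t := by simpa using (hs _ ht).2
    refine (sq_le_sq₀ (norm_nonneg _) (norm_nonneg _)).mp ?_
    rcases ht0.eq_or_lt with rfl | hpos
    · rw [abs_zero, mul_zero] at h
      exact h.trans (sq_nonneg _)
    · have hmem : √t ∈ sqrtSpectrum T := ⟨Real.sqrt_pos.mpr hpos, by rwa [Real.sq_sqrt ht0]⟩
      have h1 := hsq ⟨√t, hmem⟩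
      rw [Real.sq_sqrt ht0] at h1
      rw [← h1] at h
      exact h.trans (pow_le_pow_left₀ (norm_nonneg _) (norm_apply_le_zeroAtInfty _ _) 2)

/-- The Gelfand representation of a Banach Jordan triple system generated by one element. -/
theorem exists_gelfand (hcube : ∀ x : V, ‖tp x x x‖ = ‖x‖ ^ 3) {a : V} (ha : ‖a‖ = 1)
    {T : V →L[ℂ] V} (hT : (T : V →ₗ[ℂ] V) = L a a)
    (hs : ∀ z ∈ spectrum ℂ T, z.im = 0 ∧ 0 ≤ z.re)
    (hd : DenseRange fun p : ℂ[X] => aeval (L a a) p a) :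
    ∃ (S : Set ℝ) (Ψ : V ≃ₗᵢ[ℂ] C₀(S, ℂ)), S ⊆ Set.Ioc 0 1 ∧ IsCompact (S ∪ {0}) ∧
      IsTripleHom (Ψ.toLinearEquiv : V →ₗ[ℂ] C₀(S, ℂ)) ∧ ∀ t : S, Ψ a t = ((t : ℝ) : ℂ) := by
  have hS := sqrtSpectrum_subset_Ioc hcube ha hT hd
  have hK := isCompact_sqrtSpectrum_union_zero hS
  have ha0 : a ≠ 0 := norm_ne_zero_iff.mp (by rw [ha]; exact one_ne_zero)
  have hQ : DenseRange (oddPower a) := hd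
  have hD := denseRange_oddPolynomial hS hK
  have hnorm : ∀ p, ‖oddPolynomial hK (LinearEquiv.refl ℂ ℂ[X] p)‖ = ‖oddPower a p‖ :=
    norm_oddPolynomial hcube ha0 hT hs hd hK
  -- `V` and `C₀(S)` are both completions of `ℂ[X]` for the same seminorm.
  obtain ⟨Ψ, hΨ⟩ : ∃ Ψ : V ≃ₗᵢ[ℂ] C₀(sqrtSpectrum T, ℂ),
      ∀ p, Ψ (oddPower a p) = oddPolynomial hK p :=
    ⟨_, LinearEquiv.extendOfIsometry_eq (LinearEquiv.refl ℂ ℂ[X]) (oddPower a)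
      (oddPolynomial hK) hQ hD hnorm⟩
  refine ⟨sqrtSpectrum T, Ψ, hS, hK, isTripleHom_of_oddPower hK hcube hQ Ψ hΨ, fun t => ?_⟩
  have e : oddPower a 1 = a := by rw [oddPower_apply, map_one, Module.End.one_apply]
  have h := hΨ 1
  rw [e] at h
  rw [h, oddPolynomial_apply, eval_one, mul_one]

end Gelfand

/-! ### Rigidity of triple homomorphisms and functionals on `C₀` -/

section Rigidity

/-- Triple homomorphisms between algebras of continuous functions are contractive. -/
theorem norm_tripleHom_le {X Y : Type*} [TopologicalSpace X] [TopologicalSpace Y]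
    (Θ : C₀(X, ℂ) →ₗ[ℂ] C₀(Y, ℂ)) (hΘ : IsTripleHom Θ) (f : C₀(X, ℂ)) : ‖Θ f‖ ≤ ‖f‖ := by
  refine norm_le_zeroAtInfty _ (norm_nonneg _) fun y => ?_
  by_contra! hlt
  set μ : ℂ := Θ f y * starRingEnd ℂ (Θ f y) with hμ
  have hΘ0 : Θ f y ≠ 0 := norm_pos_iff.mp ((norm_nonneg f).trans_lt hlt)
  have hμn : ‖μ‖ = ‖Θ f y‖ ^ 2 := by
    rw [hμ, norm_mul, RCLike.norm_conj, sq]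
  let M : C₀(X, ℂ) →L[ℂ] C₀(X, ℂ) := ContinuousLinearMap.mul ℂ C₀(X, ℂ) (f * star f)
  -- Since `μ` lies outside the spectrum of multiplication by `|f|²`, the equation `μ k - |f|² k =
  -- f` has a solution. Applying `Θ` and evaluating at `y` cancels the left side, so `Θ f y = 0`, a
  -- contradiction. No continuity of `Θ` enters.
  have hM : ‖M‖ < ‖μ‖ := by
    have h1 : ‖M‖ ≤ ‖f * star f‖ := ContinuousLinearMap.opNorm_mul_apply_le ℂ C₀(X, ℂ) _
    have hstar : ‖star f‖ ≤ ‖f‖ := norm_le_zeroAtInfty _ (norm_nonneg _) fun x => by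
      rw [ZeroAtInftyContinuousMap.star_apply, norm_star]
      exact norm_apply_le_zeroAtInfty f x
    have h2 : ‖f * star f‖ ≤ ‖f‖ * ‖f‖ :=
      (norm_mul_le _ _).trans (mul_le_mul_of_nonneg_left hstar (norm_nonneg f))
    rw [hμn, sq]
    exact (h1.trans h2).trans_lt (mul_self_lt_mul_self (norm_nonneg _) hlt)
  have hne : Nontrivial C₀(X, ℂ) := ⟨f, 0, fun h => hΘ0 (by rw [h, map_zero]; rfl)⟩
  have hu : IsUnit (algebraMap ℂ (C₀(X, ℂ) →L[ℂ] C₀(X, ℂ)) μ - M) :=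
    spectrum.mem_resolventSet_of_norm_lt (𝕜 := ℂ) (A := C₀(X, ℂ) →L[ℂ] C₀(X, ℂ)) hM
  obtain ⟨W, hW⟩ := hu.exists_right_inv
  set k := W f with hk
  have h0 : μ • k - f * star f * k = f := by
    have := congrArg (fun U : C₀(X, ℂ) →L[ℂ] C₀(X, ℂ) => U f) hW
    simpa [Algebra.algebraMap_eq_smul_one, M] using this
  have h1 : μ • k - tp f f k = f := h0
  have h2 := congrArg (fun g => Θ g y) h1
  simp only [map_sub, map_smul, hΘ f f k] at h2
  have h3 : μ * Θ k y - Θ f y * starRingEnd ℂ (Θ f y) * Θ k y = Θ f y := h2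
  rw [← hμ, sub_self] at h3
  exact hΘ0 h3.symm

/-- A compact set of positive numbers, together with `0`, on which the identity has norm one
contains `1`. -/
theorem one_mem_of_one_le_norm {S : Set ℝ} (hS : S ⊆ Set.Ioc 0 1) (hK : IsCompact (S ∪ {0}))
    (f : C₀(S, ℂ)) (hf : ∀ t : S, f t = ((t : ℝ) : ℂ)) (h1 : 1 ≤ ‖f‖) : (1 : ℝ) ∈ S := by
  obtain ⟨m, hm, hmax⟩ := hK.exists_isMaxOn ⟨0, Or.inr rfl⟩ continuousOn_id
  have hm0 : 0 ≤ m := hmax (Or.inr rfl : (0 : ℝ) ∈ S ∪ {0})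
  have hfm : ‖f‖ ≤ m := norm_le_zeroAtInfty _ hm0 fun t => by
    rw [hf, Complex.norm_real, Real.norm_of_nonneg (hS t.2).1.le]
    exact hmax (Or.inl t.2)
  have hm1 := h1.trans hfm
  rcases hm with hm | hm
  · rwa [← le_antisymm (hS hm).2 hm1]
  · rw [Set.mem_singleton_iff.mp hm] at hm1
    exact absurd hm1 (by norm_num)

/-- A contractive functional on `C₀(S)`, `S ⊆ (0, 1]`, with value `1` at the identity function
vanishes at the functions that vanish at `1`. -/
theorem functional_eq_zero_of_apply_one_eq_zero {S : Set ℝ} (hS : S ⊆ Set.Ioc 0 1)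
    (h1S : (1 : ℝ) ∈ S) (ψ : C₀(S, ℂ) →ₗ[ℂ] ℂ) (hψ : ∀ f, ‖ψ f‖ ≤ ‖f‖) (i : C₀(S, ℂ))
    (hi : ∀ t : S, i t = ((t : ℝ) : ℂ)) (hψi : ψ i = 1) (g : C₀(S, ℂ)) (hg : g ⟨1, h1S⟩ = 0) :
    ψ g = 0 := by
  suffices h : ∀ δ : ℝ, 0 < δ → ‖ψ g‖ ≤ δ by
    exact norm_le_zero_iff.mp (le_of_forall_pos_le_add fun δ hδ => by simpa using h δ hδ)
  intro δ hδ
  obtain ⟨η, hη, hηg⟩ := Metric.continuousAt_iff.mp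
    (g.continuous.continuousAt (x := (⟨1, h1S⟩ : S))) δ hδ
  -- This makes `ε * ‖g‖ ≤ η`: at distance at least `η` from `1`, the loss in `t ≤ 1 - η` absorbs
  -- the perturbation, while closer to `1` it is below `ε * δ`.
  set ε : ℝ := η / (‖g‖ + 1) with hε
  have hg1 : 0 < ‖g‖ + 1 := by positivity
  have hε0 : 0 < ε := div_pos hη hg1
  have hεg : ε * ‖g‖ ≤ η := by
    rw [hε, div_mul_eq_mul_div, div_le_iff₀ hg1]
    nlinarith [norm_nonneg g]
  -- The phase `c` makes the contribution of `g` add to `ψ i = 1`, so that `1 + ε * ‖ψ g‖ ≤ 1 + ε *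
  -- δ`.
  obtain ⟨c, hc, hcψ⟩ : ∃ c : ℂ, ‖c‖ = 1 ∧ c * ψ g = ‖ψ g‖ := by
    rcases eq_or_ne (ψ g) 0 with h0 | h0
    · exact ⟨1, norm_one, by simp [h0]⟩
    · have hn : ((‖ψ g‖ : ℝ) : ℂ) ≠ 0 := by simpa using h0
      refine ⟨‖ψ g‖ / ψ g, ?_, div_mul_cancel₀ _ h0⟩
      rw [norm_div, Complex.norm_real, norm_norm, div_self (norm_ne_zero_iff.mpr h0)]
  have hbound : ‖i + ((ε : ℂ) * c) • g‖ ≤ 1 + ε * δ := by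
    refine norm_le_zeroAtInfty _ (by positivity) fun t => ?_
    have ht := hS t.2
    have hgt : ‖i t + ((ε : ℂ) * c) * g t‖ ≤ t + ε * ‖g t‖ := by
      refine (norm_add_le _ _).trans_eq ?_
      rw [hi, Complex.norm_real, Real.norm_of_nonneg ht.1.le, norm_mul, norm_mul, hc, mul_one,
        Complex.norm_real, Real.norm_of_nonneg hε0.le]
    refine hgt.trans ?_
    by_cases hclose : dist t ⟨1, h1S⟩ < η
    · have h : dist (g t) (g ⟨1, h1S⟩) < δ := hηg hclose
      rw [hg, dist_zero_right] at h
      have := mul_le_mul_of_nonneg_left h.le hε0.le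
      linarith [ht.2]
    · rw [Subtype.dist_eq, Real.dist_eq, abs_sub_comm, abs_of_nonneg (by linarith [ht.2])] at hclose
      have h2 := mul_le_mul_of_nonneg_left (norm_apply_le_zeroAtInfty g t) hε0.le
      have : 0 < ε * δ := mul_pos hε0 hδ
      linarith
  have h := (hψ _).trans hbound
  rw [map_add, map_smul, hψi, smul_eq_mul, mul_assoc, hcψ] at h
  have e : (1 : ℂ) + (ε : ℂ) * (‖ψ g‖ : ℂ) = ((1 + ε * ‖ψ g‖ : ℝ) : ℂ) := by push_cast; ring
  rw [e, Complex.norm_real, Real.norm_of_nonneg (by positivity)] at h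
  exact le_of_mul_le_mul_left (by linarith) hε0

end Rigidity

/-! ### The functional as evaluation at `1` -/

theorem proposition3 {E : Type*} [NormedAddCommGroup E] [NormedSpace ℂ E] [CompleteSpace E]
    [JBStarTriple E] (a : E) (ha : ‖a‖ = 1) (φ : E →L[ℂ] ℂ) (hφ : ‖φ‖ = 1) (hφa : φ a = 1) :
    JordanTripleSystem.IsTripleHom
        ((φ : E →ₗ[ℂ] ℂ).comp (JBStarTriple.generated a).subtype) ∧
      (∃ (S : Set ℝ) (Ψ : JBStarTriple.generated a ≃ₗᵢ[ℂ] C₀(S, ℂ)),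
        JBStarTriple.IsGelfand a S Ψ.toLinearEquiv) ∧
      ∀ (S : Set ℝ) (Ψ : JBStarTriple.generated a ≃ₗ[ℂ] C₀(S, ℂ)),
        JBStarTriple.IsGelfand a S Ψ →
          ∃ h1 : (1 : ℝ) ∈ S, ∀ x : JBStarTriple.generated a, φ (x : E) = Ψ x ⟨1, h1⟩ := by
  have hex : ∃ (S : Set ℝ) (Ψ : JBStarTriple.generated a ≃ₗᵢ[ℂ] C₀(S, ℂ)),
      JBStarTriple.IsGelfand a S Ψ.toLinearEquiv := by
    obtain ⟨T, hT, hs⟩ := JBStarTriple.exists_generated_L a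
    obtain ⟨S, Ψ, h1, h2, h3, h4⟩ := exists_gelfand (JBStarTriple.generated_norm_cube a)
      (a := ⟨a, JBStarTriple.mem_generated_self a⟩) ha hT hs
      (JBStarTriple.denseRange_aeval_generated a)
    exact ⟨S, Ψ, by rwa [ha], h2, h3, h4⟩
  have hall : ∀ (S : Set ℝ) (Ψ : JBStarTriple.generated a ≃ₗ[ℂ] C₀(S, ℂ)),
      JBStarTriple.IsGelfand a S Ψ →
        ∃ h1 : (1 : ℝ) ∈ S, ∀ x : JBStarTriple.generated a, φ (x : E) = Ψ x ⟨1, h1⟩ := by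
    rintro S Ψ ⟨hS, hK, hhom, hid⟩
    rw [ha] at hS
    obtain ⟨S₀, Ψ₀, -, -, hhom₀, -⟩ := hex
    -- Only `Ψ₀` is isometric, but `Ψ₀ ∘ Ψ⁻¹` is contractive as a triple homomorphism.
    have hle : ∀ x, ‖x‖ ≤ ‖Ψ x‖ := fun x => by
      have hΘ : IsTripleHom ((Ψ₀.toLinearEquiv : _ →ₗ[ℂ] C₀(S₀, ℂ)) ∘ₗ
          (Ψ.symm : C₀(S, ℂ) →ₗ[ℂ] _)) := fun f g h => by
        have e : Ψ.symm (tp f g h) = tp (Ψ.symm f) (Ψ.symm g) (Ψ.symm h) := by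
          rw [LinearEquiv.symm_apply_eq]
          refine Eq.trans ?_ (hhom _ _ _).symm
          simp
        refine (congrArg Ψ₀ e).trans (hhom₀ _ _ _)
      have := norm_tripleHom_le _ hΘ (Ψ x)
      simpa using this
    have hφn : ∀ x : E, ‖φ x‖ ≤ ‖x‖ := fun x => by simpa [hφ] using φ.le_opNorm x
    set b : JBStarTriple.generated a := ⟨a, JBStarTriple.mem_generated_self a⟩
    have h1 : (1 : ℝ) ∈ S := one_mem_of_one_le_norm hS hK (Ψ b) hid (ha.symm.le.trans (hle b))
    refine ⟨h1, fun x => ?_⟩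
    let ψ : C₀(S, ℂ) →ₗ[ℂ] ℂ := (φ : E →ₗ[ℂ] ℂ) ∘ₗ (JBStarTriple.generated a).subtype ∘ₗ
      (Ψ.symm : C₀(S, ℂ) →ₗ[ℂ] JBStarTriple.generated a)
    have hψ : ∀ y, ψ (Ψ y) = φ (y : E) := fun y => by simp [ψ]
    have hψn : ∀ f, ‖ψ f‖ ≤ ‖f‖ := fun f => by
      obtain ⟨y, rfl⟩ := Ψ.surjective f
      rw [hψ]
      exact (hφn y).trans (hle y)
    -- Subtracting the multiple `Ψ x 1` of `t ↦ t` from `Ψ x` gives a function vanishing at `1`.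
    have h0 := functional_eq_zero_of_apply_one_eq_zero hS h1 ψ hψn (Ψ b) hid
      ((hψ b).trans hφa) (Ψ x - (Ψ x ⟨1, h1⟩) • Ψ b) (by
        have := hid ⟨1, h1⟩
        change Ψ x ⟨1, h1⟩ - Ψ x ⟨1, h1⟩ * Ψ b ⟨1, h1⟩ = 0
        rw [this]
        simp)
    rw [map_sub, map_smul, hψ, hψ] at h0
    have hφb : φ (b : E) = 1 := hφa
    rw [hφb, smul_eq_mul, mul_one] at h0
    exact sub_eq_zero.mp h0
  refine ⟨?_, hex, hall⟩
  obtain ⟨S, Ψ, hΨ⟩ := hex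
  obtain ⟨h1, h⟩ := hall S Ψ.toLinearEquiv hΨ
  intro x y z
  change φ ((tp x y z : JBStarTriple.generated a) : E) =
    φ (x : E) * starRingEnd ℂ (φ (y : E)) * φ (z : E)
  rw [h, h, h, h]
  exact congrArg (fun f : C₀(S, ℂ) => f ⟨1, h1⟩) (hΨ.2.2.1 x y z)
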